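/- Let $\lambda\in(-1,0)$ and let $\alpha\in\mathbb{R}$ be such that $\beta:=\lambda+\alpha>1$. Let $\Psi(\tau)=\tau$ for $|\tau|\le 1$ and $\Psi(\tau)=0$ for $|\tau|>1$. On the strip $\mathcal{L}=\{(x,s): x\in\mathbb{R},\ s\in[-1,1]\}$ define the map $f:\mathcal{L}\to\mathcal{L}$ by $$f(x,s)=\bigl(x',\ \Psi(s+x'-x)\bigr),\qquad x'=\lambda x+\alpha s,$$ and let $EF=\{(x,s): x=\frac{\alpha s}{1-\lambda},\ -1\le s\le 1\}$, which is the segment of fixed points of $f$. Then: (1) for every point $(x_0,s_0)\in\mathcal{L}\setminus EF$ there is an integer $k\ge 1$ such that $f^k(x_0,s_0)$ lies on the line $s=0$; (2) there exists a non-atomic Borel probability measure $\mu$ on $\mathcal{L}$ that is invariant under $f$ and satisfies $\operatorname{supp}\mu\cap EF=\emptyset$; (3) the set of non-wandering points of $f$ that do not belong to $EF$ is uncountable. (A point $z$ is non-wandering if for every neighbourhood $U$ of $z$ there is $n\ge1$ with $f^n(U)\cap U\ne\emptyset$.) -/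

import Mathlib

noncomputable section

namespace RiskModel

/-- The discontinuous cut-off function of the interval `[-1, 1]`: it is the identity on the interval
and vanishes outside of it. -/
def cutoff (τ : ℝ) : ℝ := if 1 < |τ| then 0 else τ

theorem cutoff_mem_Icc (τ : ℝ) : cutoff τ ∈ Set.Icc (-1 : ℝ) 1 := by
  unfold cutoff
  split_ifs with h
  · norm_num
  · exact abs_le.mp (not_lt.mp h)

/-- The phase space: the strip of all `(x, s)` with `x` real and `s ∈ [-1, 1]`, with the topology
and the Borel sigma-algebra of the plane. -/
abbrev Strip : Type := ℝ × Set.Icc (-1 : ℝ) 1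

/-- The map `f` of the system `x' = l x + a s`, `s' = cutoff (s + x' - x)`, with parameters
`l` (lambda) and `a` (alpha). -/
def step (l a : ℝ) (z : Strip) : Strip :=
  (l * z.1 + a * z.2,
    ⟨cutoff (z.2 + (l * z.1 + a * z.2) - z.1), cutoff_mem_Icc _⟩)

/-- The equilibrium segment `EF`: all `(x, s)` in the strip with `x = a s / (1 - l)`. -/
def equilibria (l a : ℝ) : Set Strip := {z | z.1 = a * z.2 / (1 - l)}

/-- The point `x` is non-wandering for `g` (not necessarily continuous): every neighbourhood `U`
of `x` meets `g^n(U)` for some `n ≥ 1`. -/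
def IsNonWandering {X : Type*} [TopologicalSpace X] (g : X → X) (x : X) : Prop :=
  ∀ U ∈ nhds x, ∃ n : ℕ, 1 ≤ n ∧ (g^[n] '' U ∩ U).Nonempty

end RiskModel

end

/-!
Off the equilibrium segment, the displacement `x' - x` is multiplied by `l + a > 1` at each step until
the cut-off occurs, which gives the returns to the line `s = 0` (`exists_iterate_snd_eq_zero`).

On this line the first return by cut-off is `x ↦ - returnMap l a x`, where `returnMap l a` is an odd
map that on `(0, ∞)` is piecewise linear, `x ↦ c x` with a multiplier `c > 0` that depends on the
number of steps. Two features make it tractable. Its values at `x > 0` stay above the positive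
constant `-l / (1 - l)` (`lt_returnMap`), so that only finitely many pieces matter; and since no piece
has a constant term, each iterate is near any point, on either side, a dilation about the origin.
In logarithmic coordinates it is an interval translation map.

Hence there is a dichotomy. Either some iterate of the return map is the identity on an interval, and
images of Lebesgue measure on that interval give a non-atomic invariant measure
(`exists_invariant_measure_of_periodic`). Or every point has one-sided neighbourhoods with arbitrarily
long return times (`IsSide.exists_forall_iterate_notMem`). Then visits of an orbit to a small
neighbourhood of a point are rare, so an invariant mean along the orbit (`exists_orbit_mean`) has a
continuous distribution function; its Stieltjes measure is non-atomic, and it is invariant although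
the return map is discontinuous, because preimages of half-open intervals are finite unions of
half-open intervals up to null sets (`exists_invariant_measure_of_aperiodic`).

The tower over the symmetrization of this measure is invariant under the strip map, and on it the
displacement is bounded away from zero, so its support misses the equilibria
(`measurePreserving_towerMeasure`, `exists_invariant_measure_strip`). By Poincaré recurrence all points
of the support are non-wandering, and the support of a non-atomic probability measure is uncountable.
-/

namespace RiskModel

open Set Filter Topology MeasureTheory Function

/-! ### The return map to the line `s = 0` -/

/-- The drift coefficients: until the first cut-off, the orbit of `(x, 0)` is
`(x - x * drift l a k, - x * drift l a k)`. -/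
def drift (l a : ℝ) : ℕ → ℝ
  | 0 => 0
  | k + 1 => (1 - l) + (l + a) * drift l a k

/-- The number of steps after which the orbit of `(x, 0)` is cut off, i.e. returns to the line
`s = 0`; the value at `x = 0`, where there is no return, is `0`. -/
noncomputable def exitTime (l a x : ℝ) : ℕ := sInf {k | 1 < |x| * drift l a k}

/-- The return map to the line `s = 0`, up to sign: the orbit of `(x, 0)` with `x ≠ 0` returns to
the line at `(- returnMap l a x, 0)`. -/
noncomputable def returnMap (l a x : ℝ) : ℝ := (drift l a (exitTime l a x) - 1) * x

section ReturnMap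

variable {l a : ℝ}

theorem drift_one : drift l a 1 = 1 - l := by simp [drift]

theorem drift_add_one_le (hl : l < 0) (hb : 1 < l + a) (k : ℕ) :
    drift l a k + 1 ≤ drift l a (k + 1) ∧ 0 ≤ drift l a k := by
  induction k with
  | zero => simp [drift]; linarith
  | succ k ih =>
    have h0 : 0 ≤ drift l a (k + 1) := by linarith
    refine ⟨?_, h0⟩
    rw [drift.eq_2 l a (k + 1)]
    nlinarith

theorem drift_strictMono (hl : l < 0) (hb : 1 < l + a) : StrictMono (drift l a) :=
  strictMono_nat_of_lt_succ fun k => by linarith [(drift_add_one_le hl hb k).1]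

theorem natCast_le_drift (hl : l < 0) (hb : 1 < l + a) (k : ℕ) : (k : ℝ) ≤ drift l a k := by
  induction k with
  | zero => simp [drift]
  | succ k ih => push_cast; linarith [(drift_add_one_le hl hb k).1]

theorem one_lt_drift_succ (hl : l < 0) (hb : 1 < l + a) (k : ℕ) : 1 < drift l a (k + 1) := by
  have := (drift_strictMono hl hb).monotone (show 1 ≤ k + 1 by omega)
  rw [drift_one] at this
  linarith

theorem exists_one_lt_mul_drift (hl : l < 0) (hb : 1 < l + a) {x : ℝ} (hx : 0 < x) :
    ∃ k, 1 < x * drift l a k := by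
  obtain ⟨k, hk⟩ := exists_nat_gt (1 / x)
  refine ⟨k, ?_⟩
  have := natCast_le_drift hl hb k
  rw [div_lt_iff₀ hx] at hk
  nlinarith

theorem lt_exitTime_iff (hl : l < 0) (hb : 1 < l + a) {x : ℝ} (hx : x ≠ 0) {k : ℕ} :
    k < exitTime l a x ↔ |x| * drift l a k ≤ 1 := by
  have hx' := abs_pos.2 hx
  constructor
  · intro h
    by_contra hk
    exact absurd (Nat.sInf_le (show k ∈ {k | 1 < |x| * drift l a k} from not_le.1 hk))
      (not_le.2 h)
  · intro h
    by_contra hk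
    have h1 : 1 < |x| * drift l a (exitTime l a x) :=
      Nat.sInf_mem (exists_one_lt_mul_drift hl hb hx')
    have := (drift_strictMono hl hb).monotone (not_lt.1 hk)
    nlinarith

theorem exitTime_pos (hl : l < 0) (hb : 1 < l + a) {x : ℝ} (hx : x ≠ 0) :
    0 < exitTime l a x := (lt_exitTime_iff hl hb hx).2 (by simp [drift])

theorem exitTime_eq_succ_iff (hl : l < 0) (hb : 1 < l + a) {x : ℝ} (hx : 0 < x) {k : ℕ} :
    exitTime l a x = k + 1 ↔ x * drift l a k ≤ 1 ∧ 1 < x * drift l a (k + 1) := by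
  have h1 := lt_exitTime_iff hl hb hx.ne' (k := k)
  have h2 := lt_exitTime_iff hl hb hx.ne' (k := k + 1)
  rw [abs_of_pos hx] at h1 h2
  rw [← h1, ← not_le (a := x * drift l a (k + 1)), ← h2]
  omega

theorem exitTime_neg (x : ℝ) : exitTime l a (-x) = exitTime l a x := by simp [exitTime]

theorem returnMap_neg (x : ℝ) : returnMap l a (-x) = - returnMap l a x := by
  simp [returnMap, exitTime_neg]

theorem measurable_exitTime (hl : l < 0) (hb : 1 < l + a) : Measurable (exitTime l a) := by
  refine measurable_of_Ioi fun k => ?_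
  have : exitTime l a ⁻¹' Ioi k = {x | |x| * drift l a k ≤ 1} \ {0} := by
    ext x
    rcases eq_or_ne x 0 with rfl | hx
    · simp [exitTime, not_lt.2 (zero_le_one (α := ℝ))]
    · simp [lt_exitTime_iff hl hb hx, hx]
  rw [this]
  exact (measurableSet_le (by fun_prop) (by fun_prop)).diff (measurableSet_singleton 0)

theorem measurable_returnMap (hl : l < 0) (hb : 1 < l + a) : Measurable (returnMap l a) :=
  (measurable_from_nat (f := fun k => drift l a k - 1)).comp (measurable_exitTime hl hb)
    |>.mul measurable_id

/-- The multiplier of the return map is positive. -/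
theorem drift_exitTime_sub_one_pos (hl : l < 0) (hb : 1 < l + a) {x : ℝ} (hx : x ≠ 0) :
    0 < drift l a (exitTime l a x) - 1 := by
  obtain ⟨k, hk⟩ := Nat.exists_eq_succ_of_ne_zero (exitTime_pos hl hb hx).ne'
  rw [hk]
  linarith [one_lt_drift_succ hl hb k]

theorem returnMap_pos (hl : l < 0) (hb : 1 < l + a) {x : ℝ} (hx : 0 < x) :
    0 < returnMap l a x :=
  mul_pos (drift_exitTime_sub_one_pos hl hb hx.ne') hx

/-- Returns to the line `s = 0` stay away from the equilibrium `0`, uniformly. -/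
theorem lt_returnMap (hl : l < 0) (hb : 1 < l + a) {x : ℝ} (hx : 0 < x) :
    -l / (1 - l) < returnMap l a x := by
  obtain ⟨k, hk⟩ := Nat.exists_eq_succ_of_ne_zero (exitTime_pos hl hb hx.ne').ne'
  obtain ⟨h1, h2⟩ := (exitTime_eq_succ_iff hl hb hx).1 hk
  rw [returnMap, hk, div_lt_iff₀ (by linarith)]
  rcases k with _ | k
  · rw [Nat.succ_eq_add_one, zero_add, drift_one] at *
    nlinarith
  · have h3 := (drift_strictMono hl hb).monotone (show 1 ≤ k + 1 by omega)
    rw [drift_one] at h3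
    have : x * (1 - l) ≤ 1 := by nlinarith
    rw [Nat.succ_eq_add_one] at *
    nlinarith

theorem returnMap_le (hl : l ∈ Ioo (-1 : ℝ) 0) (hb : 1 < l + a) {x : ℝ} (hx : 0 < x) :
    returnMap l a x ≤ max x (1 + (l + a)) := by
  obtain ⟨hl1, hl⟩ := hl
  obtain ⟨k, hk⟩ := Nat.exists_eq_succ_of_ne_zero (exitTime_pos hl hb hx.ne').ne'
  obtain ⟨h1, h2⟩ := (exitTime_eq_succ_iff hl hb hx).1 hk
  rw [returnMap, hk]
  rcases k with _ | k
  · rw [Nat.succ_eq_add_one, zero_add, drift_one]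
    exact le_max_of_le_left (by nlinarith)
  · refine le_max_of_le_right ?_
    have h3 := (drift_strictMono hl hb).monotone (show 1 ≤ k + 1 by omega)
    rw [drift_one] at h3
    rw [Nat.succ_eq_add_one, drift]
    nlinarith

theorem iterate_returnMap_pos (hl : l < 0) (hb : 1 < l + a) {x : ℝ} (hx : 0 < x) (j : ℕ) :
    0 < (returnMap l a)^[j] x := by
  induction j with
  | zero => exact hx
  | succ j ih => rw [iterate_succ_apply']; exact returnMap_pos hl hb ih

end ReturnMap

/-! ### Iterates of the strip map -/

section StripMap

variable {l a : ℝ}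

/-- Before the cut-off, the displacement `x' - x` is multiplied by `l + a` at each step, so an orbit
that starts off the equilibria is cut off. -/
theorem exists_iterate_snd_eq_zero (hl : l < 0) (hb : 1 < l + a) (z : Strip)
    (hz : z ∉ equilibria l a) :
    ∃ k : ℕ, 1 ≤ k ∧ ((((step l a)^[k] z).2 : ℝ) = 0) := by
  by_contra! hcon
  set D : Strip → ℝ := fun z => l * z.1 + a * z.2 - z.1 with hD
  have hstep : ∀ w : Strip, ((step l a w).2 : ℝ) ≠ 0 →
      ((step l a w).2 : ℝ) = w.2 + D w ∧ D (step l a w) = (l + a) * D w := by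
    intro w hw
    have : ((step l a w).2 : ℝ) = w.2 + D w := by
      simp only [step, cutoff] at hw ⊢
      split_ifs at hw ⊢ with h
      · exact absurd rfl hw
      · simp only [hD]; ring
    refine ⟨this, ?_⟩
    simp only [hD] at this ⊢
    rw [this]
    simp only [step]
    ring
  have hit : ∀ k, D ((step l a)^[k] z) = (l + a) ^ k * D z := by
    intro k
    induction k with
    | zero => simp
    | succ k ih =>
      have := hcon (k + 1) (by omega)
      rw [iterate_succ_apply'] at this ⊢
      rw [(hstep _ this).2, ih]
      ring
  have hD0 : D z ≠ 0 := by
    intro h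
    apply hz
    have h1 : (1 - l) ≠ 0 := by linarith
    simp only [equilibria, mem_ofPred_eq]
    rw [eq_div_iff h1]
    simp only [hD] at h
    linarith
  have hbound : ∀ k, (l + a) ^ k * |D z| ≤ 2 := by
    intro k
    have h1 := hcon (k + 1) (by omega)
    rw [iterate_succ_apply'] at h1
    have h2 := (hstep _ h1).1
    rw [hit] at h2
    have h3 := abs_le.2 (step l a ((step l a)^[k] z)).2.2
    have h4 := abs_le.2 ((step l a)^[k] z).2.2
    have h5 : |(l + a) ^ k * D z| ≤ 2 := by
      rw [abs_le] at *
      constructor <;> linarith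
    rwa [abs_mul, abs_of_pos (by positivity)] at h5
  obtain ⟨k, hk⟩ := pow_unbounded_of_one_lt (2 / |D z|) hb
  rw [div_lt_iff₀ (abs_pos.2 hD0)] at hk
  exact absurd (hbound k) (not_le.2 hk)

theorem measurable_step : Measurable (step l a) := by
  have h : Measurable cutoff := by
    unfold cutoff
    exact Measurable.ite (measurableSet_lt measurable_const (by fun_prop)) measurable_const
      measurable_id
  unfold step
  refine Measurable.prodMk (by fun_prop) (Measurable.subtype_mk (h.comp (by fun_prop)))

/-- The point `(x, 0)` of the strip. -/
def lineEmbed (x : ℝ) : Strip := (x, ⟨0, by norm_num⟩)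

theorem measurable_lineEmbed : Measurable lineEmbed :=
  measurable_id.prodMk measurable_const

theorem iterate_step_lineEmbed (hl : l < 0) (hb : 1 < l + a) {x : ℝ} (hx : x ≠ 0) {k : ℕ}
    (hk : k < exitTime l a x) :
    ((step l a)^[k] (lineEmbed x)).1 = x - x * drift l a k ∧
      (((step l a)^[k] (lineEmbed x)).2 : ℝ) = - (x * drift l a k) := by
  induction k with
  | zero => simp [drift, lineEmbed]
  | succ k ih =>
    obtain ⟨h1, h2⟩ := ih (by omega)
    have h3 := (lt_exitTime_iff hl hb hx).1 hk
    rw [iterate_succ_apply']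
    simp only [step, h1, h2, cutoff]
    have h4 : -(x * drift l a k) + (l * (x - x * drift l a k) + a * -(x * drift l a k)) -
        (x - x * drift l a k) = -(x * drift l a (k + 1)) := by rw [drift]; ring
    rw [h4, if_neg]
    · exact ⟨by rw [drift]; ring, rfl⟩
    · rw [abs_neg, abs_mul, abs_of_nonneg (drift_add_one_le hl hb (k + 1)).2]
      exact not_lt.2 h3

/-- The first return of `(x, 0)` to the line `s = 0` by cut-off. -/
theorem iterate_exitTime_lineEmbed (hl : l < 0) (hb : 1 < l + a) {x : ℝ} (hx : x ≠ 0) :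
    (step l a)^[exitTime l a x] (lineEmbed x) = lineEmbed (- returnMap l a x) := by
  obtain ⟨k, hk⟩ := Nat.exists_eq_succ_of_ne_zero (exitTime_pos hl hb hx).ne'
  obtain ⟨h1, h2⟩ := iterate_step_lineEmbed hl hb hx (k := k) (by omega)
  have h3 : ¬ (k + 1 < exitTime l a x) := by omega
  rw [lt_exitTime_iff hl hb hx, not_le] at h3
  rw [returnMap, hk, iterate_succ_apply']
  simp only [step, h1, h2, cutoff]
  have h4 : -(x * drift l a k) + (l * (x - x * drift l a k) + a * -(x * drift l a k)) -
      (x - x * drift l a k) = -(x * drift l a (k + 1)) := by rw [drift]; ring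
  refine Prod.ext ?_ (Subtype.ext ?_)
  · simp only [lineEmbed, drift]; ring
  · simp only [lineEmbed]
    rw [h4, if_pos]
    rwa [abs_neg, abs_mul, abs_of_nonneg (drift_add_one_le hl hb (k + 1)).2]

end StripMap

/-! ### Invariant means along an orbit -/

/-- Along every orbit there is an invariant mean, namely the limit of visit frequencies along a
nonprincipal ultrafilter. If each visit to `A` is followed by at least `p` steps outside `A`, then
`A` has mean at most `1 / (p + 1)`. -/
theorem exists_orbit_mean {X : Type*} (T : X → X) (x₀ : X) :
    ∃ m : Set X → ℝ, (∀ A, 0 ≤ m A) ∧ m univ = 1 ∧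
      (∀ A B, Disjoint A B → m (A ∪ B) = m A + m B) ∧ (∀ A, m (T ⁻¹' A) = m A) ∧
      (∀ A, (∀ n, T^[n] x₀ ∉ A) → m A = 0) ∧
      ∀ A (p : ℕ), (∀ y ∈ A, ∀ j, 1 ≤ j → j ≤ p → T^[j] y ∉ A) → m A ≤ 1 / (p + 1) := by
  classical
  set h : Set X → ℕ → ℝ := fun A k => if T^[k] x₀ ∈ A then 1 else 0 with hh
  have h0 : ∀ A k, 0 ≤ h A k := fun A k => by simp only [hh]; split_ifs <;> norm_num
  have h1 : ∀ A k, h A k ≤ 1 := fun A k => by simp only [hh]; split_ifs <;> norm_num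
  set q : Set X → ℕ → ℝ := fun A n => (∑ k ∈ Finset.range n, h A k) / n with hq
  have q0 : ∀ A n, 0 ≤ q A n := fun A n =>
    div_nonneg (Finset.sum_nonneg fun k _ => h0 A k) n.cast_nonneg
  have q1 : ∀ A n, q A n ≤ 1 := fun A n => by
    refine div_le_one_of_le₀ ?_ n.cast_nonneg
    calc ∑ k ∈ Finset.range n, h A k ≤ ∑ k ∈ Finset.range n, (1 : ℝ) :=
          Finset.sum_le_sum fun k _ => h1 A k
      _ = n := by simp
  have hlim : ∀ A, ∃ c, Tendsto (q A) (hyperfilter ℕ : Filter ℕ) (𝓝 c) := by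
    intro A
    obtain ⟨c, -, hc⟩ := (isCompact_Icc (a := (0 : ℝ)) (b := 1)).ultrafilter_le_nhds
      ((hyperfilter ℕ).map (q A)) (by
        rw [le_principal_iff]
        exact Filter.mem_map.2 (Filter.univ_mem' fun n => ⟨q0 A n, q1 A n⟩))
    exact ⟨c, hc⟩
  choose m hm using hlim
  have hle : (hyperfilter ℕ : Filter ℕ) ≤ atTop := Nat.hyperfilter_le_atTop
  refine ⟨m, fun A => ge_of_tendsto' (hm A) (q0 A), ?_, ?_, ?_, ?_, ?_⟩
  · refine tendsto_nhds_unique (hm univ) (tendsto_const_nhds.congr' ?_)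
    filter_upwards [hle (eventually_gt_atTop 0)] with n hn
    have : (n : ℝ) ≠ 0 := by positivity
    simp [hq, hh, this]
  · intro A B hAB
    refine tendsto_nhds_unique (hm _) (((hm A).add (hm B)).congr fun n => ?_)
    simp only [hq]
    rw [← add_div, ← Finset.sum_add_distrib]
    congr 1
    refine Finset.sum_congr rfl fun k _ => ?_
    have hd : T^[k] x₀ ∈ A → T^[k] x₀ ∉ B := fun hA => disjoint_left.1 hAB hA
    by_cases hA : T^[k] x₀ ∈ A <;> by_cases hB : T^[k] x₀ ∈ B <;> simp_all
  · intro A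
    -- the two frequencies differ by a boundary term of size at most `1 / n`
    have key : ∀ n, q (T ⁻¹' A) n = q A n + (h A n - h A 0) * (n : ℝ)⁻¹ := by
      intro n
      have e : ∀ k, h (T ⁻¹' A) k = h A (k + 1) := fun k => by
        simp only [hh, mem_preimage, iterate_succ_apply']
      have e2 := Finset.sum_range_succ (h A) n
      rw [Finset.sum_range_succ'] at e2
      simp only [hq, e]
      rw [← div_eq_mul_inv, ← add_div]
      congr 1
      linarith
    have hz : Tendsto (fun n : ℕ => (h A n - h A 0) * (n : ℝ)⁻¹) atTop (𝓝 0) := by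
      refine bdd_le_mul_tendsto_zero' 1 (Eventually.of_forall fun n => ?_)
        tendsto_inv_atTop_nhds_zero_nat
      rw [abs_le]
      constructor <;> linarith [h0 A n, h1 A n, h0 A 0, h1 A 0]
    have := ((hm A).add (hz.mono_left hle)).congr fun n => (key n).symm
    rw [add_zero] at this
    exact tendsto_nhds_unique (hm _) this
  · intro A hA
    refine tendsto_nhds_unique (hm A) (tendsto_const_nhds.congr fun n => ?_)
    simp [hq, hh, hA]
  · intro A p hp
    -- each block of `p + 1` consecutive times contains at most one visit
    have count : ∀ n, ∑ k ∈ Finset.range n, h A k ≤ n / (p + 1) + 1 := by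
      intro n
      simp only [hh]
      rw [Finset.sum_boole]
      have hc : ((Finset.range n).filter fun k => T^[k] x₀ ∈ A).card ≤
          (Finset.range (n / (p + 1) + 1)).card := by
        refine Finset.card_le_card_of_injOn (fun k => k / (p + 1)) ?_ ?_
        · intro k hk
          simp only [Finset.coe_filter, Finset.mem_range, mem_ofPred_eq] at hk
          simp only [Finset.coe_range, mem_Iio]
          exact Nat.lt_succ_of_le (Nat.div_le_div_right hk.1.le)
        · have aux : ∀ i j, T^[i] x₀ ∈ A → T^[j] x₀ ∈ A → i / (p + 1) = j / (p + 1) →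
              ¬ i < j := by
            intro i j hi hj hij hlt
            have e1 := Nat.div_add_mod i (p + 1)
            have e2 := Nat.div_add_mod j (p + 1)
            have e3 := Nat.mod_lt j (show p + 1 > 0 by omega)
            rw [hij] at e1
            refine hp _ hi (j - i) (by omega) (by omega) ?_
            rwa [← iterate_add_apply, Nat.sub_add_cancel hlt.le]
          intro i hi j hj hij
          simp only [Finset.coe_filter, mem_ofPred_eq] at hi hj
          exact le_antisymm (not_lt.1 (aux j i hj.2 hi.2 hij.symm))
            (not_lt.1 (aux i j hi.2 hj.2 hij))
      rw [Finset.card_range] at hc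
      calc (((Finset.range n).filter fun k => T^[k] x₀ ∈ A).card : ℝ)
          ≤ ((n / (p + 1) + 1 : ℕ) : ℝ) := by exact_mod_cast hc
        _ ≤ n / (p + 1) + 1 := by
            have := @Nat.cast_div_le ℝ _ _ _ n (p + 1)
            push_cast at this ⊢
            linarith
    have hz : Tendsto (fun n : ℕ => (1 : ℝ) / (p + 1) + (n : ℝ)⁻¹) atTop
        (𝓝 (1 / (p + 1) + 0)) :=
      tendsto_const_nhds.add tendsto_inv_atTop_nhds_zero_nat
    rw [add_zero] at hz
    refine le_of_tendsto_of_tendsto (hm A) (hz.mono_left hle) ?_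
    filter_upwards [hle (eventually_gt_atTop 0)] with n hn
    have hn' : (0 : ℝ) < n := by exact_mod_cast hn
    simp only [hq]
    rw [div_le_iff₀ hn']
    calc _ ≤ _ := count n
      _ = _ := by field_simp

/-! ### The tower over a return map -/

section Tower

variable {X Y : Type*} [MeasurableSpace X] [MeasurableSpace Y]

/-- The measure on `X` obtained from a measure `ν` on a section `e : Y → X` of the map `f` by
spreading it along the orbit segments of length `N` that start in the section. -/
noncomputable def towerMeasure (f : X → X) (e : Y → X) (N : Y → ℕ) (ν : Measure Y) : Measure X :=
  Measure.sum fun k => (ν.restrict {y | k < N y}).map fun y => f^[k] (e y)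

variable {f : X → X} {e : Y → X} {S : Y → Y} {N : Y → ℕ} {ν : Measure Y}

theorem towerMeasure_apply (hf : Measurable f) (he : Measurable e)
    {A : Set X} (hA : MeasurableSet A) :
    towerMeasure f e N ν A = ∑' k, ν ((fun y => f^[k] (e y)) ⁻¹' A ∩ {y | k < N y}) := by
  have hm : ∀ k, Measurable fun y => f^[k] (e y) := fun k => (hf.iterate k).comp he
  rw [towerMeasure, Measure.sum_apply _ hA]
  refine tsum_congr fun k => ?_
  rw [Measure.map_apply (hm k) hA, Measure.restrict_apply (hm k hA)]

/-- If the orbit of the section returns to it after time `N` by a map `S` that preserves `ν`, then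
the tower over `ν` is invariant. -/
theorem measurePreserving_towerMeasure (hf : Measurable f) (he : Measurable e)
    (hN : Measurable N) (hS : MeasurePreserving S ν ν) (hpos : ∀ᵐ y ∂ν, 0 < N y)
    (hret : ∀ᵐ y ∂ν, f^[N y] (e y) = e (S y)) :
    MeasurePreserving f (towerMeasure f e N ν) (towerMeasure f e N ν) := by
  have hm : ∀ k, Measurable fun y => f^[k] (e y) := fun k => (hf.iterate k).comp he
  refine ⟨hf, Measure.ext fun A hA => ?_⟩
  rw [Measure.map_apply hf hA, towerMeasure_apply hf he (hf hA), towerMeasure_apply hf he hA]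
  set u : ℕ → ENNReal := fun k => ν ((fun y => f^[k] (e y)) ⁻¹' A ∩ {y | k < N y})
  set v : ℕ → ENNReal := fun k => ν ((fun y => f^[k + 1] (e y)) ⁻¹' A ∩ {y | N y = k + 1})
  have hsplit : ∀ k, ν ((fun y => f^[k] (e y)) ⁻¹' (f ⁻¹' A) ∩ {y | k < N y}) =
      u (k + 1) + v k := by
    intro k
    rw [← measure_inter_add_sdiff _ (hN (measurableSet_Ioi (a := k + 1)))]
    congr 2
    · ext y
      simp only [mem_inter_iff, mem_preimage, mem_ofPred_eq, mem_Ioi, iterate_succ_apply']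
      grind
    · ext y
      simp only [mem_inter_iff, Set.mem_sdiff, mem_preimage, mem_ofPred_eq, mem_Ioi,
        iterate_succ_apply']
      grind
  have hv : ∑' k, v k = u 0 := by
    have hU : ν (⋃ k, (fun y => f^[k + 1] (e y)) ⁻¹' A ∩ {y | N y = k + 1}) = ∑' k, v k := by
      refine measure_iUnion ?_ fun k => (hm _ hA).inter (hN (measurableSet_singleton (k + 1)))
      intro i j hij
      refine disjoint_left.2 fun y hi hj => hij ?_
      have h1 : N y = i + 1 := hi.2
      have h2 : N y = j + 1 := hj.2
      omega
    have h0 : u 0 = ν (e ⁻¹' A) := by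
      refine measure_congr ?_
      filter_upwards [hpos] with y hy
      exact propext ⟨fun h => h.1, fun h => ⟨h, hy⟩⟩
    rw [← hU, h0, ← hS.measure_preimage (he hA).nullMeasurableSet]
    refine measure_congr ?_
    filter_upwards [hpos, hret] with y hy hr
    refine propext ⟨fun h => ?_, fun h => ?_⟩
    · obtain ⟨k, hk, hk'⟩ := mem_iUnion.1 h
      have hk' : N y = k + 1 := hk'
      rw [hk'] at hr
      change e (S y) ∈ A
      rw [← hr]
      exact hk
    · refine mem_iUnion.2 ⟨N y - 1, ?_, (Nat.sub_add_cancel hy).symm⟩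
      change f^[N y - 1 + 1] (e y) ∈ A
      rw [Nat.sub_add_cancel hy, hr]
      exact h
  rw [tsum_congr hsplit, ENNReal.tsum_add, hv, tsum_eq_zero_add' (f := u) ENNReal.summable,
    add_comm]

theorem le_towerMeasure_univ (hf : Measurable f) (he : Measurable e)
    (hpos : ∀ᵐ y ∂ν, 0 < N y) : ν univ ≤ towerMeasure f e N ν univ := by
  rw [towerMeasure_apply hf he .univ]
  refine le_trans (le_of_eq ?_) (ENNReal.le_tsum 0)
  refine measure_congr ?_
  filter_upwards [hpos] with y hy
  exact propext ⟨fun _ => ⟨trivial, hy⟩, fun _ => trivial⟩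

theorem isFiniteMeasure_towerMeasure [IsFiniteMeasure ν] (hf : Measurable f) (he : Measurable e)
    {K : ℕ} (hK : ∀ᵐ y ∂ν, N y ≤ K) : IsFiniteMeasure (towerMeasure f e N ν) := by
  refine ⟨?_⟩
  rw [towerMeasure_apply hf he .univ, tsum_eq_sum (s := Finset.range K)]
  · exact ENNReal.sum_lt_top.2 fun k _ => measure_lt_top _ _
  · intro k hk
    refine measure_mono_null inter_subset_right ?_
    rw [Finset.mem_range, not_lt] at hk
    refine measure_mono_null (fun y (hy : k < N y) => ?_) (ae_iff.1 hK)
    exact not_le.2 (hk.trans_lt hy)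

end Tower

/-! ### From the return map to the strip -/

/-- Every point of the support of a finite invariant measure is non-wandering, by Poincaré
recurrence. -/
theorem isNonWandering_of_mem_support {X : Type*} [TopologicalSpace X] [MeasurableSpace X]
    [OpensMeasurableSpace X] {f : X → X} {μ : Measure X} [IsFiniteMeasure μ]
    (hf : MeasurePreserving f μ μ) {x : X} (hx : x ∈ μ.support) : IsNonWandering f x := by
  intro U hU
  obtain ⟨V, hVU, hV, hxV⟩ := mem_nhds_iff.1 hU
  have hpos := (Measure.mem_support_iff_forall x).1 hx V (hV.mem_nhds hxV)
  obtain ⟨y, hy, n, hn, hny⟩ :=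
    hf.exists_mem_iterate_mem hV.measurableSet.nullMeasurableSet hpos.ne'
  exact ⟨n, Nat.one_le_iff_ne_zero.2 hn, _, mem_image_of_mem _ (hVU hy), hVU hny⟩

/-- The symmetrization of a non-atomic invariant measure of the return map spreads to a non-atomic
invariant measure of the strip map. -/
theorem exists_invariant_measure_strip {l a : ℝ} (hl : l < 0) (hb : 1 < l + a) (ν : Measure ℝ)
    [IsFiniteMeasure ν] (hν0 : ν univ ≠ 0) (hν : ∀ x, ν {x} = 0)
    (hinv : MeasurePreserving (returnMap l a) ν ν) (hsupp : ∀ᵐ x ∂ν, -l / (1 - l) < x) :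
    ∃ μ : Measure Strip, IsProbabilityMeasure μ ∧ (∀ z : Strip, μ {z} = 0) ∧
      MeasurePreserving (step l a) μ μ ∧ μ.support ∩ equilibria l a = ∅ := by
  have hδ : 0 < -l / (1 - l) := div_pos (by linarith) (by linarith)
  have hg := measurable_returnMap hl hb
  -- the return map on the line is `x ↦ - returnMap l a x`, which is odd
  set ρ : Measure ℝ := ν + ν.map Neg.neg with hρ
  have hρabs : ∀ᵐ x ∂ρ, -l / (1 - l) < |x| := by
    rw [hρ, ae_add_measure_iff, ae_map_iff (by fun_prop)
      (measurableSet_lt measurable_const (by fun_prop))]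
    constructor
    · filter_upwards [hsupp] with x hx using hx.trans_le (le_abs_self x)
    · filter_upwards [hsupp] with x hx
      rw [abs_neg]
      exact hx.trans_le (le_abs_self x)
  have hρ0 : ∀ᵐ x ∂ρ, x ≠ 0 := by
    filter_upwards [hρabs] with x hx h
    rw [h, abs_zero] at hx
    linarith
  have hρatom : ∀ x, ρ {x} = 0 := by
    intro x
    rw [hρ, Measure.add_apply, Measure.map_apply measurable_neg (measurableSet_singleton x), hν,
      zero_add]
    have : Neg.neg ⁻¹' {x} = {-x} := by ext y; simp
    rw [this, hν]
  have hS : MeasurePreserving (fun x => - returnMap l a x) ρ ρ := by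
    refine ⟨hg.neg, ?_⟩
    have hg' : Measurable fun x => - returnMap l a x := hg.neg
    rw [hρ, Measure.map_add _ _ hg', Measure.map_map hg' measurable_neg, add_comm]
    congr 1
    · have : (fun x => - returnMap l a x) ∘ Neg.neg = returnMap l a := by
        ext x; simp [returnMap_neg]
      rw [this, hinv.map_eq]
    · have : (fun x => - returnMap l a x) = Neg.neg ∘ returnMap l a := rfl
      rw [this, ← Measure.map_map measurable_neg hg, hinv.map_eq]
  have hpos : ∀ᵐ x ∂ρ, 0 < exitTime l a x := by
    filter_upwards [hρ0] with x hx using exitTime_pos hl hb hx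
  have hret : ∀ᵐ x ∂ρ, (step l a)^[exitTime l a x] (lineEmbed x) =
      lineEmbed (- returnMap l a x) := by
    filter_upwards [hρ0] with x hx using iterate_exitTime_lineEmbed hl hb hx
  obtain ⟨K, hK⟩ := exists_one_lt_mul_drift hl hb hδ
  have hbdd : ∀ᵐ x ∂ρ, exitTime l a x ≤ K := by
    filter_upwards [hρ0, hρabs] with x hx hx'
    by_contra h
    have h1 := (lt_exitTime_iff hl hb hx).1 (not_le.1 h)
    have h2 := (drift_add_one_le hl hb K).2
    nlinarith
  have hf := measurable_step (l := l) (a := a)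
  have he := measurable_lineEmbed
  have hN := measurable_exitTime hl hb
  set M := towerMeasure (step l a) lineEmbed (exitTime l a) ρ with hM
  have hMinv : MeasurePreserving (step l a) M M :=
    measurePreserving_towerMeasure hf he hN hS hpos hret
  have : IsFiniteMeasure M := isFiniteMeasure_towerMeasure hf he hbdd
  have hM0 : M univ ≠ 0 := by
    have h1 : ρ univ ≤ M univ := le_towerMeasure_univ hf he hpos
    have h2 : ν univ ≤ ρ univ := by rw [hρ]; exact le_self_add
    exact ((pos_iff_ne_zero.2 hν0).trans_le (h2.trans h1)).ne'
  have hatom : ∀ z, M {z} = 0 := by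
    intro z
    rw [hM, towerMeasure_apply hf he (measurableSet_singleton z), ENNReal.tsum_eq_zero]
    intro k
    -- `x - s` is constant along an orbit until the cut-off
    have hsub : (fun y => (step l a)^[k] (lineEmbed y)) ⁻¹' {z} ∩ {y | k < exitTime l a y} ⊆
        {z.1 - z.2} ∪ {0} := by
      rintro y ⟨hy, hyk⟩
      rcases eq_or_ne y 0 with h0 | h0
      · exact Or.inr h0
      · refine Or.inl ?_
        obtain ⟨h1, h2⟩ := iterate_step_lineEmbed hl hb h0 hyk
        have hy : (step l a)^[k] (lineEmbed y) = z := hy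
        rw [hy] at h1 h2
        rw [mem_singleton_iff, h1, h2]
        ring
    refine measure_mono_null hsub ?_
    rw [measure_union_null_iff]
    exact ⟨hρatom _, hρatom _⟩
  -- the displacement `x' - x` has size at least `-l` on the tower and vanishes on the equilibria
  set U : Set Strip := {z | |l * z.1 + a * z.2 - z.1| < -l} with hU
  have hUo : IsOpen U := isOpen_lt (by fun_prop) continuous_const
  have hMU : M U = 0 := by
    rw [hM, towerMeasure_apply hf he hUo.measurableSet, ENNReal.tsum_eq_zero]
    intro k
    rw [← nonpos_iff_eq_zero, ← show ρ {x | ¬ (x ≠ 0 ∧ -l / (1 - l) < |x|)} = 0 from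
      hρ0.and hρabs]
    refine measure_mono ?_
    rintro y ⟨hy, hyk⟩ ⟨h0, hya⟩
    obtain ⟨h1, h2⟩ := iterate_step_lineEmbed hl hb h0 hyk
    simp only [hU, mem_preimage, mem_ofPred_eq, h1, h2] at hy
    have e : l * (y - y * drift l a k) + a * -(y * drift l a k) - (y - y * drift l a k) =
        - (y * ((1 - l) + (l + a - 1) * drift l a k)) := by ring
    have h3 : 0 ≤ (l + a - 1) * drift l a k :=
      mul_nonneg (by linarith) (drift_add_one_le hl hb k).2
    rw [e, abs_neg, abs_mul, abs_of_pos (a := (1 - l) + (l + a - 1) * drift l a k)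
      (by linarith)] at hy
    rw [div_lt_iff₀ (by linarith)] at hya
    nlinarith [abs_nonneg y]
  have hEU : equilibria l a ⊆ U := by
    intro z hz
    have h1 : (1 - l) ≠ 0 := by linarith
    simp only [equilibria, mem_ofPred_eq] at hz
    rw [eq_div_iff h1] at hz
    have : l * z.1 + a * z.2 - z.1 = 0 := by linarith
    simp only [hU, mem_ofPred_eq, this, abs_zero]
    linarith
  refine ⟨(M univ)⁻¹ • M, ⟨?_⟩, fun z => ?_, hMinv.smul_measure _, ?_⟩
  · rw [Measure.smul_apply, smul_eq_mul]
    exact ENNReal.inv_mul_cancel hM0 (measure_ne_top _ _)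
  · rw [Measure.smul_apply, hatom, smul_zero]
  · rw [← disjoint_iff_inter_eq_empty, disjoint_right]
    intro z hz
    refine Measure.notMem_support_iff_exists.2 ⟨U, hUo.mem_nhds (hEU hz), ?_⟩
    rw [Measure.smul_apply, hMU, smul_zero]

/-! ### Local behaviour of the return map -/

section Local

variable {l a : ℝ}

theorem eventually_exitTime_eq_nhdsGT (hl : l < 0) (hb : 1 < l + a) {d : ℝ} (hd : 0 < d) :
    ∃ k, ∀ᶠ y in 𝓝[>] d, exitTime l a y = k + 1 := by
  classical
  have hex : ∃ n, 1 ≤ d * drift l a n :=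
    (exists_one_lt_mul_drift hl hb hd).imp fun _ h => h.le
  have h0 : Nat.find hex ≠ 0 := by
    intro h
    have := Nat.find_spec hex
    rw [h] at this
    simp [drift] at this
    linarith
  obtain ⟨k, hk⟩ := Nat.exists_eq_succ_of_ne_zero h0
  have h1 := Nat.find_spec hex
  rw [hk] at h1
  have h2 : d * drift l a k < 1 := not_le.1 (Nat.find_min hex (m := k) (by omega))
  have hc : ContinuousAt (fun y => y * drift l a k) d := by fun_prop
  refine ⟨k, ?_⟩
  filter_upwards [self_mem_nhdsWithin, mem_nhdsWithin_of_mem_nhds (hc.eventually_lt_const h2)]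
    with y hy hy2
  have hy : d < y := hy
  refine (exitTime_eq_succ_iff hl hb (hd.trans hy)).2 ⟨hy2.le, h1.trans_lt ?_⟩
  exact mul_lt_mul_of_pos_right hy (by linarith [one_lt_drift_succ hl hb k])

theorem eventually_exitTime_eq_nhdsLE (hl : l < 0) (hb : 1 < l + a) {d : ℝ} (hd : 0 < d) :
    ∃ k, ∀ᶠ y in 𝓝[≤] d, exitTime l a y = k + 1 := by
  obtain ⟨k, hk⟩ := Nat.exists_eq_succ_of_ne_zero (exitTime_pos hl hb hd.ne').ne'
  obtain ⟨h1, h2⟩ := (exitTime_eq_succ_iff hl hb hd).1 hk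
  have hc : ContinuousAt (fun y => y * drift l a (k + 1)) d := by fun_prop
  refine ⟨k, ?_⟩
  filter_upwards [self_mem_nhdsWithin, mem_nhdsWithin_of_mem_nhds (hc.eventually_const_lt h2),
    mem_nhdsWithin_of_mem_nhds (lt_mem_nhds hd)] with y hy hy2 hy0
  have hy : y ≤ d := hy
  refine (exitTime_eq_succ_iff hl hb hy0).2 ⟨le_trans ?_ h1, hy2⟩
  exact mul_le_mul_of_nonneg_right hy (drift_add_one_le hl hb k).2

/-- A choice of side: a family of filters like `𝓝[>] d` or `𝓝[≤] d`, for `d > 0`, that is carried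
along by dilations, whose members contain intervals, and along which the exit time is eventually
constant, so that the return map is eventually a dilation. -/
structure IsSide (l a : ℝ) (L : ℝ → Filter ℝ) : Prop where
  le_nhds : ∀ d, L d ≤ 𝓝 d
  tendsto_mul : ∀ C > 0, ∀ d > 0, Tendsto (fun y => C * y) (L d) (L (C * d))
  exitTime_eq : ∀ d > 0, ∃ k, ∀ᶠ y in L d, exitTime l a y = k + 1
  exists_Ioo_subset : ∀ d > 0, ∀ V ∈ L d, ∃ u v, 0 < u ∧ u < v ∧ Ioo u v ⊆ V

theorem isSide_nhdsGT (hl : l < 0) (hb : 1 < l + a) : IsSide l a fun d => 𝓝[>] d where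
  le_nhds d := nhdsWithin_le_nhds
  tendsto_mul C hC d hd := by
    have hc : ContinuousAt (fun y => C * y) d := by fun_prop
    refine tendsto_nhdsWithin_iff.2 ⟨hc.tendsto.mono_left nhdsWithin_le_nhds, ?_⟩
    filter_upwards [self_mem_nhdsWithin] with y hy
    exact mul_lt_mul_of_pos_left (show d < y from hy) hC
  exitTime_eq d hd := eventually_exitTime_eq_nhdsGT hl hb hd
  exists_Ioo_subset d hd V hV := by
    obtain ⟨v, hv, hV⟩ := mem_nhdsGT_iff_exists_Ioo_subset.1 hV
    exact ⟨d, v, hd, hv, hV⟩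

theorem isSide_nhdsLE (hl : l < 0) (hb : 1 < l + a) : IsSide l a fun d => 𝓝[≤] d where
  le_nhds d := nhdsWithin_le_nhds
  tendsto_mul C hC d hd := by
    have hc : ContinuousAt (fun y => C * y) d := by fun_prop
    refine tendsto_nhdsWithin_iff.2 ⟨hc.tendsto.mono_left nhdsWithin_le_nhds, ?_⟩
    filter_upwards [self_mem_nhdsWithin] with y hy
    exact mul_le_mul_of_nonneg_left (show y ≤ d from hy) hC.le
  exitTime_eq d hd := eventually_exitTime_eq_nhdsLE hl hb hd
  exists_Ioo_subset d hd V hV := by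
    obtain ⟨u, hu, hV⟩ := mem_nhdsLE_iff_exists_Ioc_subset.1 hV
    refine ⟨max u (d / 2), d, by positivity, max_lt hu (by linarith), ?_⟩
    exact fun y hy => hV ⟨(le_max_left _ _).trans_lt hy.1, hy.2.le⟩

variable {L : ℝ → Filter ℝ}

theorem IsSide.iterate_returnMap_eq (hl : l < 0) (hb : 1 < l + a) (hL : IsSide l a L)
    {d : ℝ} (hd : 0 < d) (j : ℕ) :
    ∃ C > 0, ∀ᶠ y in L d, (returnMap l a)^[j] y = C * y := by
  induction j with
  | zero => exact ⟨1, one_pos, by simp⟩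
  | succ j ih =>
    obtain ⟨C, hC, h⟩ := ih
    obtain ⟨k, hk⟩ := hL.exitTime_eq (C * d) (by positivity)
    refine ⟨(drift l a (k + 1) - 1) * C,
      mul_pos (by linarith [one_lt_drift_succ hl hb k]) hC, ?_⟩
    filter_upwards [h, (hL.tendsto_mul C hC d hd).eventually hk] with y hy hy'
    rw [iterate_succ_apply', hy, returnMap, hy', mul_assoc]

/-- If no iterate of the return map is the identity on an interval, then each point has one-sided
neighbourhoods with arbitrarily long return times: an iterate is a dilation there, which moves the
point unless it is the identity. -/
theorem IsSide.exists_forall_iterate_notMem (hl : l < 0) (hb : 1 < l + a) (hL : IsSide l a L)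
    (hap : ∀ p, 1 ≤ p → ∀ u v, 0 < u → u < v → ∃ y ∈ Ioo u v, (returnMap l a)^[p] y ≠ y)
    {d : ℝ} (hd : 0 < d) (p : ℕ) :
    ∃ V ∈ L d, ∀ y ∈ V, ∀ j, 1 ≤ j → j ≤ p → (returnMap l a)^[j] y ∉ V := by
  induction p with
  | zero => exact ⟨univ, univ_mem, fun y _ j h1 h2 => by omega⟩
  | succ p ih =>
    obtain ⟨V, hV, h⟩ := ih
    obtain ⟨C, hC, hCy⟩ := hL.iterate_returnMap_eq hl hb hd (p + 1)
    have hC1 : d ≠ C * d := by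
      intro hCd
      have hC1 : C = 1 := by
        have : (C - 1) * d = 0 := by linarith
        rcases mul_eq_zero.1 this with h | h <;> linarith
      obtain ⟨u, v, hu, huv, hsub⟩ := hL.exists_Ioo_subset d hd _ hCy
      obtain ⟨y, hy, hne⟩ := hap (p + 1) (by omega) u v hu huv
      have : (returnMap l a)^[p + 1] y = C * y := hsub hy
      rw [hC1, one_mul] at this
      exact hne this
    obtain ⟨W₁, W₂, h1, h2, hdis⟩ := t2_separation_nhds hC1
    have hc : ContinuousAt (fun y => C * y) d := by fun_prop
    refine ⟨V ∩ {y | (returnMap l a)^[p + 1] y = C * y} ∩ (W₁ ∩ (fun y => C * y) ⁻¹' W₂),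
      inter_mem (inter_mem hV hCy) (hL.le_nhds d (inter_mem h1 (hc h2))), ?_⟩
    rintro y ⟨⟨hyV, hyC⟩, -, hy2⟩ j hj1 hj2 ⟨⟨hjV, -⟩, hj3, -⟩
    rcases Nat.lt_or_ge j (p + 1) with hlt | hge
    · exact h y hyV j hj1 (by omega) hjV
    · have : j = p + 1 := by omega
      subst this
      have hyC : (returnMap l a)^[p + 1] y = C * y := hyC
      rw [hyC] at hj3
      exact disjoint_left.1 hdis hj3 hy2

end Local

/-! ### Invariant measures of the return map -/

section InvariantMeasure

variable {l a : ℝ}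

/-- An interval of periodic points carries an invariant measure: the sum of the images of Lebesgue
measure over a period. -/
theorem exists_invariant_measure_of_periodic (hl : l < 0) (hb : 1 < l + a) {p : ℕ} (hp : 1 ≤ p)
    {u v : ℝ} (hu : 0 < u) (huv : u < v) (hper : ∀ y ∈ Ioo u v, (returnMap l a)^[p] y = y) :
    ∃ ν : Measure ℝ, IsFiniteMeasure ν ∧ ν univ ≠ 0 ∧ (∀ x, ν {x} = 0) ∧
      MeasurePreserving (returnMap l a) ν ν ∧ ∀ᵐ x ∂ν, -l / (1 - l) < x := by
  have hg := measurable_returnMap hl hb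
  set μ : Measure ℝ := volume.restrict (Ioo u v) with hμ
  have hmem : ∀ᵐ y ∂μ, y ∈ Ioo u v := ae_restrict_mem measurableSet_Ioo
  have hpos : ∀ᵐ y ∂μ, 0 < (fun _ : ℝ => p) y := Eventually.of_forall fun _ => hp
  refine ⟨towerMeasure (returnMap l a) id (fun _ => p) μ,
    isFiniteMeasure_towerMeasure (K := p) hg measurable_id (Eventually.of_forall fun _ => le_rfl),
    ?_, fun x => ?_, ?_, ?_⟩
  · refine ((pos_iff_ne_zero.2 ?_).trans_le (le_towerMeasure_univ hg measurable_id hpos)).ne'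
    simp [hμ, huv]
  · rw [towerMeasure_apply hg measurable_id (measurableSet_singleton x), ENNReal.tsum_eq_zero]
    intro k
    refine measure_mono_null (t := {(returnMap l a)^[p - k] x} ∪ (Ioo u v)ᶜ) ?_
      (measure_union_null_iff.2 ⟨by simp, hmem⟩)
    rintro y ⟨hy, hk⟩
    by_cases hyI : y ∈ Ioo u v
    · refine Or.inl ?_
      have hy : (returnMap l a)^[k] y = x := hy
      have hk : k < p := hk
      rw [mem_singleton_iff, ← hy, ← iterate_add_apply, Nat.sub_add_cancel hk.le, hper y hyI]
    · exact Or.inr hyI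
  · refine measurePreserving_towerMeasure hg measurable_id measurable_const
      (MeasurePreserving.id μ) hpos ?_
    filter_upwards [hmem] with y hy using hper y hy
  · have hms : MeasurableSet {x : ℝ | ¬ -l / (1 - l) < x} := measurableSet_Ioi.compl
    rw [ae_iff, towerMeasure_apply hg measurable_id hms, ENNReal.tsum_eq_zero]
    intro k
    refine measure_mono_null (t := (Ioo u v)ᶜ) ?_ hmem
    rintro y ⟨hy, -⟩ hyI
    refine hy ?_
    change _ < (returnMap l a)^[k] y
    rw [← hper y hyI, ← iterate_add_apply, ← Nat.sub_add_cancel (show 1 ≤ k + p by omega),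
      iterate_succ_apply']
    exact lt_returnMap hl hb (iterate_returnMap_pos hl hb (hu.trans hyI.1) _)

/-- Without intervals of periodic points, the distribution function of an invariant mean along an
orbit is continuous, because visits to small one-sided neighbourhoods are rare. Its Stieltjes
measure is invariant, because preimages of half-open intervals are, up to null sets, finite unions of
half-open intervals, on which measure and mean agree. -/
theorem exists_invariant_measure_of_aperiodic (hl : l ∈ Ioo (-1 : ℝ) 0) (hb : 1 < l + a)
    (hap : ∀ p, 1 ≤ p → ∀ u v, 0 < u → u < v → ∃ y ∈ Ioo u v, (returnMap l a)^[p] y ≠ y) :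
    ∃ ν : Measure ℝ, IsFiniteMeasure ν ∧ ν univ ≠ 0 ∧ (∀ x, ν {x} = 0) ∧
      MeasurePreserving (returnMap l a) ν ν ∧ ∀ᵐ x ∂ν, -l / (1 - l) < x := by
  have hl' := hl.2
  have hg := measurable_returnMap hl' hb
  set δ := -l / (1 - l) with hδdef
  have hδ : 0 < δ := div_pos (by linarith) (by linarith)
  have hδ1 : δ < 1 := by rw [hδdef, div_lt_one (by linarith)]; linarith
  have horb : ∀ n, δ < (returnMap l a)^[n] 1 ∧ (returnMap l a)^[n] 1 ≤ 1 + (l + a) := by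
    intro n
    induction n with
    | zero => exact ⟨hδ1, by simp; linarith⟩
    | succ n ih =>
      rw [iterate_succ_apply']
      have h0 := hδ.trans ih.1
      exact ⟨lt_returnMap hl' hb h0, (returnMap_le hl hb h0).trans (max_le ih.2 le_rfl)⟩
  obtain ⟨m, m0, m1, madd, minv, mnull, mgap⟩ := exists_orbit_mean (returnMap l a) 1
  have mmono : ∀ A B, A ⊆ B → m A ≤ m B := by
    intro A B h
    have := madd A (B \ A) disjoint_sdiff_right
    rw [union_sdiff_cancel h] at this
    linarith [m0 (B \ A)]
  have mlow : ∀ A, A ⊆ Iic δ → m A = 0 := fun A hA =>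
    mnull A fun n hn => absurd (hA hn) (not_le.2 (horb n).1)
  have mIoc : ∀ x y, x ≤ y → m (Iic y) - m (Iic x) = m (Ioc x y) := by
    intro x y hxy
    rw [← Iic_union_Ioc_eq_Iic hxy, madd _ _ (Iic_disjoint_Ioc le_rfl)]
    ring
  have hsmall : ∀ L, IsSide l a L → ∀ d (p : ℕ), ∃ V ∈ L d, m V ≤ 1 / (p + 1) := by
    intro L hL d p
    rcases lt_or_ge d δ with hd | hd
    · refine ⟨Iio δ, hL.le_nhds d (Iio_mem_nhds hd), ?_⟩
      rw [mlow _ Iio_subset_Iic_self]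
      positivity
    · obtain ⟨V, hV, h⟩ := hL.exists_forall_iterate_notMem hl' hb hap (hδ.trans_le hd) p
      exact ⟨V, hV, mgap V p h⟩
  have hright : ∀ d, ContinuousWithinAt (fun x => m (Iic x)) (Ici d) d := by
    intro d
    rw [← continuousWithinAt_Ioi_iff_Ici, Metric.continuousWithinAt_iff']
    intro ε hε
    obtain ⟨p, hp⟩ := exists_nat_one_div_lt hε
    obtain ⟨V, hV, hmV⟩ := hsmall _ (isSide_nhdsGT hl' hb) d p
    obtain ⟨w, hw, hsub⟩ := mem_nhdsGT_iff_exists_Ioo_subset.1 hV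
    filter_upwards [Ioo_mem_nhdsGT hw] with y hy
    rw [Real.dist_eq, mIoc d y hy.1.le, abs_of_nonneg (m0 _)]
    refine lt_of_le_of_lt ((mmono _ _ fun z hz => hsub ⟨hz.1, hz.2.trans_lt hy.2⟩).trans hmV) hp
  set F : StieltjesFunction ℝ :=
    ⟨fun x => m (Iic x), fun x y h => mmono _ _ (Iic_subset_Iic.2 h), hright⟩ with hF
  have hFapp : ∀ x, F x = m (Iic x) := fun x => rfl
  have hbot : Tendsto F atBot (𝓝 0) := by
    refine tendsto_const_nhds.congr' ?_
    filter_upwards [eventually_le_atBot δ] with x hx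
    rw [hFapp, mlow _ (Iic_subset_Iic.2 hx)]
  have htop : Tendsto F atTop (𝓝 1) := by
    refine tendsto_const_nhds.congr' ?_
    filter_upwards [eventually_ge_atTop (1 + (l + a))] with x hx
    have h1 := madd (Iic x) (Ioi x) (Iic_disjoint_Ioi le_rfl)
    have h2 : m (Ioi x) = 0 := mnull _ fun n hn => absurd (hx.trans_lt hn) (not_lt.2 (horb n).2)
    rw [Iic_union_Ioi, m1, h2] at h1
    rw [hFapp]
    linarith
  have hprob : IsProbabilityMeasure F.measure := F.isProbabilityMeasure hbot htop
  have hνlow : F.measure (Iic δ) = 0 := by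
    rw [F.measure_Iic hbot, hFapp, mlow _ subset_rfl]
    simp
  refine ⟨F.measure, inferInstance, by simp, fun d => ?_, ⟨hg, ?_⟩, ?_⟩
  · have hlim : Tendsto (fun p : ℕ => ENNReal.ofReal (1 / ((p : ℝ) + 1))) atTop (𝓝 0) := by
      have := ENNReal.tendsto_ofReal (tendsto_one_div_add_atTop_nhds_zero_nat (𝕜 := ℝ))
      rwa [ENNReal.ofReal_zero] at this
    refine nonpos_iff_eq_zero.1 (ge_of_tendsto' hlim fun p => ?_)
    obtain ⟨V, hV, hmV⟩ := hsmall _ (isSide_nhdsLE hl' hb) d p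
    obtain ⟨w, hw, hsub⟩ := mem_nhdsLE_iff_exists_Ioc_subset.1 hV
    have hw : w < d := hw
    calc F.measure {d} ≤ F.measure (Ioc w d) :=
          measure_mono (singleton_subset_iff.2 ⟨hw, le_rfl⟩)
      _ = ENNReal.ofReal (m (Ioc w d)) := by
          rw [F.measure_Ioc, hFapp, hFapp, mIoc w d hw.le]
      _ ≤ _ := ENNReal.ofReal_le_ofReal ((mmono _ _ hsub).trans hmV)
  · -- the sets on which the measure is given by the mean
    set Good : Set ℝ → Prop := fun A => MeasurableSet A ∧ F.measure A = ENNReal.ofReal (m A)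
    have gIoc : ∀ x y, Good (Ioc x y) := by
      intro x y
      refine ⟨measurableSet_Ioc, ?_⟩
      rcases le_total x y with h | h
      · rw [F.measure_Ioc, hFapp, hFapp, mIoc x y h]
      · rw [Ioc_eq_empty (not_lt.2 h), mnull ∅ fun n hn => hn]
        simp
    have gunion : ∀ A B, Good A → Good B → Disjoint A B → Good (A ∪ B) := by
      intro A B hA hB hAB
      refine ⟨hA.1.union hB.1, ?_⟩
      rw [measure_union hAB hB.1, hA.2, hB.2, madd _ _ hAB, ENNReal.ofReal_add (m0 _) (m0 _)]
    have gpiece : ∀ x y k, Good {z | (0 < z ∧ exitTime l a z = k + 1) ∧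
        returnMap l a z ∈ Ioc x y} := by
      intro x y k
      have hc : 0 < drift l a (k + 1) - 1 := by linarith [one_lt_drift_succ hl' hb k]
      have ht : 0 < drift l a (k + 1) := by linarith
      have hcond : ∀ z, ((0 < z ∧ exitTime l a z = k + 1) ∧ returnMap l a z ∈ Ioc x y) ↔
          z * drift l a k ≤ 1 ∧ 1 / drift l a (k + 1) < z ∧
            x / (drift l a (k + 1) - 1) < z ∧ z ≤ y / (drift l a (k + 1) - 1) := by
        intro z
        rw [div_lt_iff₀ ht, div_lt_iff₀ hc, le_div_iff₀ hc]
        constructor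
        · rintro ⟨⟨hz, hk⟩, h1, h2⟩
          have := (exitTime_eq_succ_iff hl' hb hz).1 hk
          rw [returnMap, hk, mul_comm] at h1 h2
          exact ⟨this.1, this.2, h1, h2⟩
        · rintro ⟨h1, h2, h3, h4⟩
          have hz : 0 < z := pos_of_mul_pos_left (zero_lt_one.trans h2) ht.le
          have hk := (exitTime_eq_succ_iff hl' hb hz).2 ⟨h1, h2⟩
          refine ⟨⟨hz, hk⟩, ?_⟩
          rw [returnMap, hk, mul_comm]
          exact ⟨h3, h4⟩
      simp only [hcond]
      rcases k with _ | k
      · convert gIoc (max (1 / drift l a (0 + 1)) (x / (drift l a (0 + 1) - 1)))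
          (y / (drift l a (0 + 1) - 1)) using 1
        ext z
        simp only [mem_ofPred_eq, mem_Ioc, max_lt_iff, drift, mul_zero, zero_le_one, true_and,
          and_assoc]
      · convert gIoc (max (1 / drift l a (k + 1 + 1)) (x / (drift l a (k + 1 + 1) - 1)))
          (min (1 / drift l a (k + 1)) (y / (drift l a (k + 1 + 1) - 1))) using 1
        ext z
        have ht' : 0 < drift l a (k + 1) := by linarith [one_lt_drift_succ hl' hb k]
        simp only [mem_ofPred_eq, mem_Ioc, max_lt_iff, le_min_iff, le_div_iff₀ ht']
        tauto
    have gpieces : ∀ x y K, Good {z | (0 < z ∧ exitTime l a z ≤ K) ∧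
        returnMap l a z ∈ Ioc x y} := by
      intro x y K
      induction K with
      | zero =>
        convert gIoc 0 0
        ext z
        simp only [mem_ofPred_eq, mem_Ioc, Nat.le_zero]
        constructor
        · rintro ⟨⟨hz, h0⟩, -⟩
          exact absurd h0 (exitTime_pos hl' hb hz.ne').ne'
        · rintro ⟨h1, h2⟩
          exact absurd h1 (not_lt.2 h2)
      | succ K ih =>
        convert gunion _ _ ih (gpiece x y K) ?_
        · ext z
          simp only [mem_ofPred_eq, mem_union, Nat.le_succ_iff]
          tauto
        · refine disjoint_left.2 fun z h1 h2 => ?_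
          have h1 := h1.1.2
          have h2 := h2.1.2
          omega
    obtain ⟨K, hK⟩ := exists_one_lt_mul_drift hl' hb hδ
    have hbdd : ∀ z, δ < z → 0 < z ∧ exitTime l a z ≤ K := by
      intro z hz
      refine ⟨hδ.trans hz, ?_⟩
      by_contra h
      have h1 := (lt_exitTime_iff hl' hb (hδ.trans hz).ne').1 (not_le.1 h)
      rw [abs_of_pos (hδ.trans hz)] at h1
      have h2 := (drift_add_one_le hl' hb K).2
      nlinarith
    have gpre : ∀ x y, Good (returnMap l a ⁻¹' Ioc x y) := by
      intro x y
      rw [← inter_union_sdiff (returnMap l a ⁻¹' Ioc x y) {z | 0 < z ∧ exitTime l a z ≤ K}]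
      have hrest : returnMap l a ⁻¹' Ioc x y \ {z | 0 < z ∧ exitTime l a z ≤ K} ⊆ Iic δ :=
        fun z hz => not_lt.1 fun h => hz.2 (hbdd z h)
      refine gunion _ _ ?_ ⟨?_, ?_⟩ (disjoint_sdiff_right.mono_left inter_subset_right)
      · rw [inter_comm]
        exact gpieces x y K
      · exact (hg measurableSet_Ioc).diff (measurableSet_Ioi.inter
          (measurable_exitTime hl' hb measurableSet_Iic))
      · rw [measure_mono_null hrest hνlow, mlow _ hrest, ENNReal.ofReal_zero]
    have : IsProbabilityMeasure (F.measure.map (returnMap l a)) :=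
      Measure.isProbabilityMeasure_map hg.aemeasurable
    refine Measure.ext_of_Ioc _ _ fun x y _ => ?_
    rw [Measure.map_apply hg measurableSet_Ioc, (gpre x y).2, minv, (gIoc x y).2]
  · rw [ae_iff]
    exact measure_mono_null (fun x hx => not_lt.1 hx) hνlow

theorem exists_invariant_measure_returnMap (hl : l ∈ Ioo (-1 : ℝ) 0) (hb : 1 < l + a) :
    ∃ ν : Measure ℝ, IsFiniteMeasure ν ∧ ν univ ≠ 0 ∧ (∀ x, ν {x} = 0) ∧
      MeasurePreserving (returnMap l a) ν ν ∧ ∀ᵐ x ∂ν, -l / (1 - l) < x := by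
  by_cases hper : ∃ p, 1 ≤ p ∧ ∃ u v, 0 < u ∧ u < v ∧ ∀ y ∈ Ioo u v, (returnMap l a)^[p] y = y
  · obtain ⟨p, hp, u, v, hu, huv, h⟩ := hper
    exact exists_invariant_measure_of_periodic hl.2 hb hp hu huv h
  · push Not at hper
    exact exists_invariant_measure_of_aperiodic hl hb hper

end InvariantMeasure

end RiskModel

theorem theorem3 (l a : ℝ) (hl : l ∈ Set.Ioo (-1 : ℝ) 0) (hb : 1 < l + a) :
    (∀ z : RiskModel.Strip, z ∉ RiskModel.equilibria l a →
      ∃ k : ℕ, 1 ≤ k ∧ ((((RiskModel.step l a)^[k] z).2 : ℝ) = 0)) ∧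
    (∃ μ : MeasureTheory.Measure RiskModel.Strip,
      MeasureTheory.IsProbabilityMeasure μ ∧ (∀ z : RiskModel.Strip, μ {z} = 0) ∧
      MeasureTheory.MeasurePreserving (RiskModel.step l a) μ μ ∧
      μ.support ∩ RiskModel.equilibria l a = ∅) ∧
    ¬ {z : RiskModel.Strip |
        RiskModel.IsNonWandering (RiskModel.step l a) z ∧
          z ∉ RiskModel.equilibria l a}.Countable := by
  obtain ⟨ν, _, hν0, hνatom, hinv, hsupp⟩ := RiskModel.exists_invariant_measure_returnMap hl hb
  obtain ⟨μ, hμ, hatom, hμinv, hμsupp⟩ :=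
    RiskModel.exists_invariant_measure_strip hl.2 hb ν hν0 hνatom hinv hsupp
  refine ⟨RiskModel.exists_iterate_snd_eq_zero hl.2 hb, ⟨μ, hμ, hatom, hμinv, hμsupp⟩, ?_⟩
  -- the support consists of such points and has full measure, so it is not countable
  intro hcount
  have : MeasureTheory.NullSingletonClass μ := ⟨hatom⟩
  have h0 : μ μ.support = 0 := by
    refine (hcount.mono fun z hz => ?_).measure_zero μ
    exact ⟨RiskModel.isNonWandering_of_mem_support hμinv hz,
      fun hE => (Set.ext_iff.1 hμsupp z).1 ⟨hz, hE⟩⟩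
  have h1 : μ Set.univ = 0 := by
    rw [← Set.union_compl_self μ.support, MeasureTheory.measure_union_null_iff]
    exact ⟨h0, MeasureTheory.Measure.measure_compl_support⟩
  rw [MeasureTheory.measure_univ] at h1
  exact one_ne_zero h1
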